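/- Let $G$ be a finite-dimensional real Lie group (not necessarily connected) that is $k$-step nilpotent, i.e. $G_{k+1}=\{1\}$, where $G_1=G$ and $G_{j+1}=[G_j,G]$. Let $\Gamma\le G$ be a discrete cocompact subgroup, so that $X=G/\Gamma$ is a $k$-step nilmanifold, and let $d_X$ be any metric on $X$ that induces the quotient topology (for example one that is invariant under translations). A subset $Y\subseteq X$ is called a subnilmanifold if it is closed and of the form $Y=H\cdot x$ for some closed subgroup $H\le G$ and some point $x\in X$. Then there exists $\varepsilon>0$ such that every subnilmanifold $Y\subseteq X$ with $\operatorname{diam}_{d_X}(Y)<\varepsilon$ consists of a single point. -/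

import Mathlib

open scoped Manifold ContDiff

/-- The homogeneous space `G ⧸ Γ` is a `k`-step nilmanifold: `G` is `k`-step nilpotent, i.e. the
`(k+1)`-st term of its lower central series `G_1 = G, G_{j+1} = [G_j, G]` is trivial
(Mathlib numbers the series from `0`), and the subgroup `Γ` is discrete and cocompact.
The Lie group structure of `G` is supplied separately by Mathlib's `LieGroup`;
`G` need not be connected. -/
structure IsNilmanifold {G : Type*} [Group G] [TopologicalSpace G]
    (k : ℕ) (Γ : Subgroup G) : Prop where
  lowerCentralSeries_eq_bot : (⊤ : Subgroup G).lowerCentralSeries k = ⊥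
  discrete : DiscreteTopology Γ
  cocompact : CompactSpace (G ⧸ Γ)

/-- A subnilmanifold of `G ⧸ Γ` is a closed subset of the form `H · x`, for a closed
subgroup `H` of `G` and a point `x`. -/
def IsSubnilmanifold {G : Type*} [Group G] [TopologicalSpace G]
    (Γ : Subgroup G) (Y : Set (G ⧸ Γ)) : Prop :=
  IsClosed Y ∧ ∃ (H : Subgroup G) (x : G ⧸ Γ), IsClosed (H : Set G) ∧ Y = MulAction.orbit H x

/-! If `H · gΓ` is small, a Lebesgue number puts `g⁻¹Hg` inside `UΓ` for a small neighborhood `U` of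
`1`; it remains to deduce `g⁻¹Hg ≤ Γ`. The iterated normalizers of `Γ` reach `G` after `k` steps, by
nilpotency. Descending this series, a subgroup `H` that normalizes a term `Λ` gives a group `HΛ ⊆
UΛ`, so it suffices that a closed `Λ` is isolated among its overgroups
(`Subgroup.exists_nhds_forall_le_of_subset_mul`). That is a relative no-small-subgroups argument.
Otherwise ever closer overgroups contain almost shortest coset representatives `u n` tending to `1`,
whose directions subconverge. A power of a much shorter `u m` then nearly equals `u n` and lies
close to `Λ`; dividing by it shortens `u n` within its coset, a contradiction. -/

open Filter Topology

/-! ### Multiplication in a chart at the identity -/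

/-- Near the identity of a Lie group there is a coordinate `f` in which multiplication is, up to
an error with arbitrarily small Lipschitz constant `η`, the addition of the model space. -/
theorem exists_almost_additive_coordinate {E : Type*} [NormedAddCommGroup E] [NormedSpace ℝ E]
    [FiniteDimensional ℝ E] {G : Type*} [Group G] [TopologicalSpace G] [ChartedSpace E G]
    [LieGroup 𝓘(ℝ, E) ∞ G] {η : ℝ} (hη : 0 < η) :
    ∃ f : G → E, ∃ W ∈ 𝓝 (1 : G), f 1 = 0 ∧ ContinuousAt f 1 ∧
      (∀ O ∈ 𝓝 (1 : G), ∃ δ > 0, ∀ g ∈ W, ‖f g‖ < δ → g ∈ O) ∧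
      ∀ a ∈ W, ∀ b ∈ W, ∀ a' ∈ W, ∀ b' ∈ W,
        ‖f (a * b) - f (a' * b') - ((f a - f a') + (f b - f b'))‖
          ≤ η * (‖f a - f a'‖ + ‖f b - f b'‖) := by
  set φ := extChartAt 𝓘(ℝ, E) (1 : G) with hφ
  set p : E := φ 1 with hp
  have hsymm_p : φ.symm p = 1 := extChartAt_to_inv (I := 𝓘(ℝ, E)) (1 : G)
  have hsource : φ.source ∈ 𝓝 (1 : G) := extChartAt_source_mem_nhds (I := 𝓘(ℝ, E)) 1
  have htarget : φ.target ∈ 𝓝 p := extChartAt_target_mem_nhds (I := 𝓘(ℝ, E)) 1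
  have hφ_cont : ContinuousAt φ 1 := continuousAt_extChartAt (I := 𝓘(ℝ, E)) 1
  have hsymm_cont : ContinuousAt φ.symm p := continuousAt_extChartAt_symm (I := 𝓘(ℝ, E)) 1
  let F : E × E → E := fun z ↦ φ (φ.symm z.1 * φ.symm z.2)
  have : IsManifold 𝓘(ℝ, E) ∞ G := ContMDiffMul.toIsManifold
  have hsymm_smooth : ContMDiffAt 𝓘(ℝ, E) 𝓘(ℝ, E) ∞ φ.symm p :=
    (contMDiffOn_extChartAt_symm (I := 𝓘(ℝ, E)) (n := ∞) (1 : G)).contMDiffAt htarget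
  have hF_smooth : ContMDiffAt 𝓘(ℝ, E × E) 𝓘(ℝ, E) ∞ F (p, p) := by
    have h₁ : ContMDiffAt 𝓘(ℝ, E × E) 𝓘(ℝ, E) ∞ (fun z : E × E ↦ φ.symm z.1) (p, p) :=
      ContMDiffAt.comp (p, p) (g := φ.symm) (f := Prod.fst) hsymm_smooth
        contDiff_fst.contMDiff.contMDiffAt
    have h₂ : ContMDiffAt 𝓘(ℝ, E × E) 𝓘(ℝ, E) ∞ (fun z : E × E ↦ φ.symm z.2) (p, p) :=
      ContMDiffAt.comp (p, p) (g := φ.symm) (f := Prod.snd) hsymm_smooth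
        contDiff_snd.contMDiff.contMDiffAt
    have h₃ : ContMDiffAt 𝓘(ℝ, E) 𝓘(ℝ, E) ∞ φ (φ.symm (p, p).1 * φ.symm (p, p).2) := by
      simp only [hsymm_p, mul_one]
      exact contMDiffAt_extChartAt (I := 𝓘(ℝ, E)) (n := ∞) (x := (1 : G))
    exact ContMDiffAt.comp (p, p) (g := φ) (f := fun z : E × E ↦ φ.symm z.1 * φ.symm z.2)
      h₃ (h₁.mul h₂)
  -- Strict differentiability compares any two points near `(p, p)`, hence the Lipschitz form of the
  -- error.
  have hF := hF_smooth.contDiffAt.hasStrictFDerivAt (by simp)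
  set D := fderiv ℝ F (p, p) with hD
  -- Multiplying by `1` on either side is the identity, so both partial derivatives are too.
  have hD_apply : ∀ v w : E, D (v, w) = v + w := by
    have hl : D.comp (.inl ℝ E E) = .id ℝ E := by
      refine HasFDerivAt.unique (f := id) (x := p) ?_ (hasFDerivAt_id p)
      refine (hF.hasFDerivAt.comp (f := fun e ↦ (e, p)) p (hasFDerivAt_prodMk_left p p)).congr_of_eventuallyEq ?_
      filter_upwards [htarget] with x hx
      simp [F, hsymm_p, φ.right_inv hx]
    have hr : D.comp (.inr ℝ E E) = .id ℝ E := by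
      refine HasFDerivAt.unique (f := id) (x := p) ?_ (hasFDerivAt_id p)
      refine (hF.hasFDerivAt.comp (f := fun e ↦ (p, e)) p (hasFDerivAt_prodMk_right p p)).congr_of_eventuallyEq ?_
      filter_upwards [htarget] with x hx
      simp [F, hsymm_p, φ.right_inv hx]
    intro v w
    have h₁ := DFunLike.congr_fun hl v
    have h₂ := DFunLike.congr_fun hr w
    simp only [ContinuousLinearMap.comp_apply, ContinuousLinearMap.inl_apply,
      ContinuousLinearMap.inr_apply, ContinuousLinearMap.id_apply] at h₁ h₂
    rw [← h₁, ← h₂, ← map_add]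
    simp [h₁, h₂]
  obtain ⟨ε, hε, hbound⟩ := Metric.eventually_nhds_iff.mp (hF.isLittleO.def hη)
  refine ⟨fun g ↦ φ g - p, φ.source ∩ φ ⁻¹' Metric.ball p ε,
    inter_mem hsource (hφ_cont (Metric.ball_mem_nhds p hε)), by simp [hp],
    hφ_cont.sub continuousAt_const, ?_, ?_⟩
  · intro O hO
    obtain ⟨δ, hδ, hball⟩ := Metric.mem_nhds_iff.mp (hsymm_cont (by rwa [hsymm_p]))
    refine ⟨δ, hδ, fun g hg hgδ ↦ ?_⟩
    have := hball (show φ g ∈ Metric.ball p δ by rwa [mem_ball_iff_norm])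
    rwa [Set.mem_preimage, φ.left_inv hg.1] at this
  · rintro a ⟨ha, ha'⟩ b ⟨hb, hb'⟩ c ⟨hc, hc'⟩ d ⟨hd, hd'⟩
    have h := hbound (y := ((φ a, φ b), (φ c, φ d))) (by
      simp only [Prod.dist_eq, max_lt_iff]
      exact ⟨⟨ha', hb'⟩, ⟨hc', hd'⟩⟩)
    simp only [F, φ.left_inv ha, φ.left_inv hb, φ.left_inv hc, φ.left_inv hd, Prod.mk_sub_mk,
      hD_apply, Prod.norm_mk] at h
    simp only [sub_sub_sub_cancel_right]
    refine h.trans (mul_le_mul_of_nonneg_left ?_ hη.le)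
    exact max_le (le_add_of_nonneg_right (norm_nonneg _)) (le_add_of_nonneg_left (norm_nonneg _))

/-! ### No small subgroups relative to a closed subgroup -/

section NoSmallSubgroups

variable {E : Type*} [NormedAddCommGroup E] {G : Type*} [Group G]
  {f : G → E} {W : Set G}

/-- Multiplication in the coordinate `f` differs from addition by a map with Lipschitz
constant `1 / 16` on `W`. -/
def IsAlmostAdditiveOn (f : G → E) (W : Set G) : Prop :=
  ∀ a ∈ W, ∀ b ∈ W, ∀ a' ∈ W, ∀ b' ∈ W,
    ‖f (a * b) - f (a' * b') - ((f a - f a') + (f b - f b'))‖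
      ≤ 1 / 16 * (‖f a - f a'‖ + ‖f b - f b'‖)

theorem IsAlmostAdditiveOn.norm_mul_sub_le (hf : IsAlmostAdditiveOn f W) (h₁ : f 1 = 0)
    (hW : (1 : G) ∈ W) {a b : G} (ha : a ∈ W) (hb : b ∈ W) :
    ‖f (a * b) - f a - f b‖ ≤ 1 / 16 * ‖f b‖ := by
  have h := hf a ha b hb a ha 1 hW
  simpa [h₁, sub_sub] using h

theorem IsAlmostAdditiveOn.norm_mul_sub_le' (hf : IsAlmostAdditiveOn f W) (h₁ : f 1 = 0)
    (hW : (1 : G) ∈ W) {a b : G} (ha : a ∈ W) (hb : b ∈ W) :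
    ‖f (a * b) - f b - f a‖ ≤ 1 / 16 * ‖f a‖ := by
  have h := hf a ha b hb 1 hW b hb
  simpa [h₁, sub_sub] using h

/-- As long as `j • f x` stays small, `f (x ^ j)` is close to `j • f x`. -/
theorem IsAlmostAdditiveOn.pow_mem_and_norm_sub_le [NormedSpace ℝ E]
    (hf : IsAlmostAdditiveOn f W) (h₁ : f 1 = 0)
    (hW : (1 : G) ∈ W) {O : Set G} (hO₁ : (1 : G) ∈ O) (hOW : O ⊆ W)
    (hOO : ∀ a ∈ O, ∀ b ∈ O, a * b ∈ W) {δ : ℝ} (hδ : ∀ g ∈ W, ‖f g‖ < δ → g ∈ O)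
    {x : G} (hx : x ∈ O) (j : ℕ) (hj : 2 * (j * ‖f x‖) < δ) :
    x ^ j ∈ O ∧ ‖f (x ^ j) - (j : ℝ) • f x‖ ≤ 1 / 16 * (j * ‖f x‖) := by
  induction j with
  | zero => simp [h₁, hO₁]
  | succ j ih =>
    have hnn := norm_nonneg (f x)
    push_cast at hj ⊢
    obtain ⟨hmem, hle⟩ := ih (by nlinarith)
    have hstep := hf.norm_mul_sub_le h₁ hW (hOW hmem) (hOW hx)
    have hle' : ‖f (x ^ (j + 1)) - ((j : ℝ) + 1) • f x‖ ≤ 1 / 16 * ((j + 1) * ‖f x‖) := by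
      calc ‖f (x ^ (j + 1)) - ((j : ℝ) + 1) • f x‖
          = ‖(f (x ^ j * x) - f (x ^ j) - f x) + (f (x ^ j) - (j : ℝ) • f x)‖ := by
            rw [pow_succ]; congr 1; module
        _ ≤ 1 / 16 * ‖f x‖ + 1 / 16 * (j * ‖f x‖) := (norm_add_le _ _).trans (by gcongr)
        _ = _ := by ring
    refine ⟨hδ _ ?_ ?_, hle'⟩
    · rw [pow_succ]; exact hOO _ hmem _ hx
    -- The norm is at most `17 / 16 * ((j + 1) * ‖f x‖)`, which the factor 2 in `hj` keeps below
    -- `δ`.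
    · have h := norm_le_norm_add_norm_sub' (f (x ^ (j + 1))) (((j : ℝ) + 1) • f x)
      rw [norm_smul, Real.norm_of_nonneg (by positivity)] at h
      have : 0 ≤ ((j : ℝ) + 1) * ‖f x‖ := by positivity
      linarith

variable [TopologicalSpace G] [IsTopologicalGroup G]

/-- A coset of a closed subgroup other than the subgroup itself has elements which, up to a factor
of two, are as close as possible to the identity. -/
theorem exists_almost_minimal_representative {Λ : Subgroup G} (hΛ : IsClosed (Λ : Set G))
    (hsmall : ∀ O ∈ 𝓝 (1 : G), ∃ δ > 0, ∀ g ∈ W, ‖f g‖ < δ → g ∈ O)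
    {h : G} (hhW : h ∈ W) (hh : h ∉ Λ) :
    ∃ u ∈ W, h⁻¹ * u ∈ Λ ∧ 0 < ‖f u‖ ∧ ∀ w ∈ W, u⁻¹ * w ∈ Λ → ‖f u‖ < 2 * ‖f w‖ := by
  set S : Set ℝ := (fun w ↦ ‖f w‖) '' {w | w ∈ W ∧ h⁻¹ * w ∈ Λ} with hS
  have hne : S.Nonempty := ⟨_, h, ⟨hhW, by simp⟩, rfl⟩
  -- The closed coset `hΛ` misses `1`, so its elements in `W` have norms bounded below. The infimum
  -- need not be attained, hence the factor 2.
  have hO : {g : G | h⁻¹ * g ∉ Λ} ∈ 𝓝 (1 : G) := by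
    refine (hΛ.isOpen_compl.preimage (continuous_const_mul h⁻¹)).mem_nhds ?_
    simpa using hh
  obtain ⟨δ, hδ, hδO⟩ := hsmall _ hO
  have hδS : ∀ s ∈ S, δ ≤ s := by
    rintro _ ⟨w, ⟨hwW, hw⟩, rfl⟩
    by_contra! hlt
    exact hδO w hwW hlt hw
  have hI : 0 < sInf S := hδ.trans_le (le_csInf hne hδS)
  obtain ⟨_, ⟨u, ⟨huW, hu⟩, rfl⟩, hlt⟩ :=
    exists_lt_of_csInf_lt hne (by linarith : sInf S < 2 * sInf S)
  refine ⟨u, huW, hu, hδ.trans_le (hδS _ ⟨u, ⟨huW, hu⟩, rfl⟩), fun w hwW hw ↦ hlt.trans_le ?_⟩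
  have : sInf S ≤ ‖f w‖ :=
    csInf_le ⟨δ, hδS⟩ ⟨w, ⟨hwW, by simpa [mul_assoc] using mul_mem hu hw⟩, rfl⟩
  linarith

/-- If `u` and the much smaller `x` point in almost the same direction, and the powers of `x` stay
close to `Λ`, then the coset `u Λ` has an element much smaller than `u`. -/
theorem exists_smaller_representative [NormedSpace ℝ E]
    (hf : IsAlmostAdditiveOn f W) (h₁ : f 1 = 0) (hW : W ∈ 𝓝 (1 : G))
    (hsmall : ∀ O ∈ 𝓝 (1 : G), ∃ δ > 0, ∀ g ∈ W, ‖f g‖ < δ → g ∈ O) :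
    ∃ δ > 0, ∀ (Λ : Subgroup G), ∀ u ∈ W, ∀ x ∈ W, 0 < ‖f u‖ → ‖f u‖ < δ →
      0 < ‖f x‖ → ‖f x‖ ≤ ‖f u‖ / 16 →
      ‖‖f x‖⁻¹ • f x - ‖f u‖⁻¹ • f u‖ ≤ 1 / 8 →
      (∀ j : ℕ, ∃ o ∈ W, ‖f o‖ ≤ ‖f u‖ / 16 ∧ o⁻¹ * x ^ j ∈ Λ) →
      ∃ w ∈ W, u⁻¹ * w ∈ Λ ∧ 2 * ‖f w‖ ≤ ‖f u‖ := by
  have h1W : (1 : G) ∈ W := mem_of_mem_nhds hW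
  obtain ⟨O, hO, hOW⟩ : ∃ O ∈ 𝓝 (1 : G), O ⊆ W ∧ (∀ a ∈ O, ∀ b ∈ O, a * b ∈ W) ∧
      (∀ a ∈ O, ∀ b ∈ O, a * b⁻¹ ∈ W) ∧ ∀ a ∈ O, ∀ b ∈ O, ∀ c ∈ O, a * b⁻¹ * c ∈ W := by
    have hc : ContinuousAt (fun z : G × G × G ↦ z.1 * z.2.1⁻¹ * z.2.2) (1, 1, 1) := by fun_prop
    have hc' : ContinuousAt (fun z : G × G ↦ z.1 * z.2) (1, 1) := by fun_prop
    have h₃ := hc.preimage_mem_nhds (t := W) (by simpa using hW)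
    have h₂ := hc'.preimage_mem_nhds (t := W) (by simpa using hW)
    rw [nhds_prod_eq] at h₂ h₃
    rw [nhds_prod_eq] at h₃
    obtain ⟨A, hA, B, hB, hAB⟩ := mem_prod_iff.mp h₃
    obtain ⟨C, hC, D, hD, hCD⟩ := mem_prod_iff.mp hB
    obtain ⟨A', hA', B', hB', hAB'⟩ := mem_prod_iff.mp h₂
    have key : ∀ a ∈ A, ∀ b ∈ C, ∀ c ∈ D, a * b⁻¹ * c ∈ W := fun a ha b hb c hc ↦
      hAB (show (a, b, c) ∈ A ×ˢ B from ⟨ha, hCD ⟨hb, hc⟩⟩)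
    refine ⟨A ∩ C ∩ D ∩ A' ∩ B' ∩ W, by simp only [inter_mem_iff]; tauto, fun a ha ↦ ha.2,
      fun a ha b hb ↦ hAB' (show (a, b) ∈ A' ×ˢ B' from ⟨ha.1.1.2, hb.1.2⟩), fun a ha b hb ↦ ?_,
      fun a ha b hb c hc ↦ key a ha.1.1.1.1.1 b hb.1.1.1.1.2 c hc.1.1.1.2⟩
    simpa using key a ha.1.1.1.1.1 b hb.1.1.1.1.2 1 (mem_of_mem_nhds hD)
  obtain ⟨hOW, hmul, hdiv, hdivmul⟩ := hOW
  obtain ⟨δ, hδ, hδO⟩ := hsmall O hO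
  refine ⟨δ / 2, by positivity, fun Λ u hu x hx hu0 huδ hx0 hxu hdir hpow ↦ ?_⟩
  set r := ‖f u‖ with hr
  set s := ‖f x‖ with hs
  -- With this exponent `j * s` falls short of `r` by less than `s ≤ r / 16`.
  set j := ⌊r / s⌋₊ with hj
  have hjs : j * s ≤ r := by
    rw [← le_div_iff₀ hx0]; exact Nat.floor_le (by positivity)
  have hjs' : r < (j + 1) * s := by
    rw [← div_lt_iff₀ hx0]; exact Nat.lt_floor_add_one _
  have huO : u ∈ O := hδO u hu (by linarith)
  have hxO : x ∈ O := hδO x hx (by linarith)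
  obtain ⟨hyO, hy⟩ := hf.pow_mem_and_norm_sub_le h₁ h1W (mem_of_mem_nhds hO) hOW hmul hδO hxO j
    (by linarith)
  obtain ⟨o, hoW, hor, ho⟩ := hpow j
  have hoO : o ∈ O := hδO o hoW (by linarith)
  set y := x ^ j with hy_def
  have hyu : ‖f u - f y‖ ≤ r / 4 := by
    -- The errors come from rounding (`r / 16`), direction (`r / 8`) and non-additivity (`r / 16`).
    have e : f u - f y = (r - j * s) • (s⁻¹ • f x) - r • (s⁻¹ • f x - r⁻¹ • f u)
        - (f y - (j : ℝ) • f x) := by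
      have e₁ : (s⁻¹ * s) • f x = f x := by rw [inv_mul_cancel₀ hx0.ne', one_smul]
      have e₂ : (r * r⁻¹) • f u = f u := by rw [mul_inv_cancel₀ hu0.ne', one_smul]
      have e₃ : ((j : ℝ) * s) • s⁻¹ • f x = (j : ℝ) • f x := by
        rw [smul_smul, mul_assoc, mul_inv_cancel₀ hx0.ne', mul_one]
      rw [sub_smul, e₃, smul_sub, smul_smul r r⁻¹, e₂]; abel
    have n₁ : ‖(r - j * s) • (s⁻¹ • f x)‖ ≤ r / 16 := by
      rw [norm_smul, norm_smul, norm_inv, norm_norm, inv_mul_cancel₀ hx0.ne', mul_one,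
        Real.norm_of_nonneg (by linarith)]
      linarith
    have n₂ : ‖r • (s⁻¹ • f x - r⁻¹ • f u)‖ ≤ r * (1 / 8) := by
      rw [norm_smul, Real.norm_of_nonneg hu0.le]; gcongr
    rw [e]
    refine (norm_sub_le _ _).trans ((add_le_add_left (norm_sub_le _ _) _).trans ?_)
    linarith
  -- Since `u = (u * y⁻¹) * y`, the error is `‖f (u * y⁻¹)‖ / 16`; absorbing it turns `r / 4` into
  -- `4 / 15 * r`.
  have hz : ‖f (u * y⁻¹)‖ ≤ 4 / 15 * r := by
    have h := hf.norm_mul_sub_le' h₁ h1W (hdiv u huO y hyO) (hOW hyO)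
    rw [inv_mul_cancel_right] at h
    have := norm_sub_norm_le (f (u * y⁻¹)) (f u - f y)
    rw [norm_sub_rev (f (u * y⁻¹))] at this
    linarith
  -- As `y⁻¹ * o ∈ Λ`, this stays in `uΛ` without `Λ` being normal. Its norm is at most `4 / 15 * r
  -- + 17 / 16 * (r / 16) < r / 2`.
  refine ⟨u * y⁻¹ * o, hdivmul u huO y hyO o hoO, ?_, ?_⟩
  · have := inv_mem ho
    simpa [mul_assoc] using this
  · have h := hf.norm_mul_sub_le h₁ h1W (hdiv u huO y hyO) hoW
    have h₂ := norm_sub_norm_le (f (u * y⁻¹ * o)) (f (u * y⁻¹) + f o)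
    rw [← sub_sub] at h₂
    have := norm_add_le (f (u * y⁻¹)) (f o)
    linarith

end NoSmallSubgroups

/-- A closed subgroup `Λ` of a Lie group is isolated among the subgroups containing it: such a
subgroup is equal to `Λ` if it is contained in `U Λ`, for a neighborhood `U` of `1` depending
only on `Λ`. -/
theorem Subgroup.exists_nhds_forall_le_of_subset_mul {E : Type*} [NormedAddCommGroup E]
    [NormedSpace ℝ E] [FiniteDimensional ℝ E] {G : Type*} [Group G] [TopologicalSpace G]
    [ChartedSpace E G] [LieGroup 𝓘(ℝ, E) ∞ G] (Λ : Subgroup G) (hΛ : IsClosed (Λ : Set G)) :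
    ∃ U ∈ 𝓝 (1 : G), ∀ H : Subgroup G, Λ ≤ H → (∀ h ∈ H, ∃ o ∈ U, o⁻¹ * h ∈ Λ) → H ≤ Λ := by
  have : IsTopologicalGroup G := topologicalGroup_of_lieGroup 𝓘(ℝ, E) ∞
  obtain ⟨f, W, hW, h₁, hcont, hsmall, hf⟩ :=
    exists_almost_additive_coordinate (E := E) (G := G) (η := 1 / 16) (by norm_num)
  obtain ⟨δ, hδ, hkey⟩ := exists_smaller_representative (f := f) hf h₁ hW hsmall
  have hball : ∀ r > 0, {g ∈ W | ‖f g‖ < r} ∈ 𝓝 (1 : G) := fun r hr ↦ by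
    refine inter_mem hW (hcont.norm.eventually_lt continuousAt_const ?_)
    simpa [h₁] using hr
  by_contra! hcon
  have hseq : ∀ n : ℕ, ∃ H : Subgroup G,
      (∀ h ∈ H, ∃ o ∈ W, ‖f o‖ < 1 / ((n : ℝ) + 1) ∧ o⁻¹ * h ∈ Λ) ∧
      ∃ u ∈ W, u ∈ H ∧ 0 < ‖f u‖ ∧ ‖f u‖ < 2 * (1 / ((n : ℝ) + 1)) ∧
        ∀ w ∈ W, u⁻¹ * w ∈ Λ → ‖f u‖ < 2 * ‖f w‖ := by
    intro n
    obtain ⟨H, hΛH, hHU, hHΛ⟩ := hcon _ (hball (1 / ((n : ℝ) + 1)) (by positivity))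
    obtain ⟨h, hhH, hh⟩ := SetLike.not_le_iff_exists.mp hHΛ
    obtain ⟨o, ⟨hoW, hon⟩, ho⟩ := hHU h hhH
    -- `h` may be far from `1`; `o` represents the same coset near `1`.
    have hoΛ : o ∉ Λ := fun h' ↦ hh (by simpa using mul_mem h' ho)
    have hoH : o ∈ H := by
      have := mul_mem hhH (inv_mem (hΛH ho))
      simpa using this
    obtain ⟨u, huW, hu, hu0, hmin⟩ :=
      exists_almost_minimal_representative hΛ hsmall hoW hoΛ
    refine ⟨H, fun h hh ↦ ?_, u, huW, by simpa using mul_mem hoH (hΛH hu), hu0, ?_, hmin⟩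
    · obtain ⟨o, ⟨hoW, hon⟩, ho⟩ := hHU h hh
      exact ⟨o, hoW, hon, ho⟩
    · have := hmin o hoW (by simpa using inv_mem hu)
      linarith
  choose H hHΛ u huW huH hu0 hun hmin using hseq
  have hsphere : ∀ n, ‖f (u n)‖⁻¹ • f (u n) ∈ Metric.sphere (0 : E) 1 := fun n ↦ by
    simp [norm_smul, (hu0 n).ne']
  obtain ⟨v, -, ψ, hψ, hlim⟩ := (isCompact_sphere (0 : E) 1).tendsto_subseq hsphere
  have hzero : Tendsto (fun n ↦ 2 * (1 / (((ψ n : ℕ) : ℝ) + 1))) atTop (𝓝 0) := by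
    simpa using (tendsto_one_div_add_atTop_nhds_zero_nat.comp hψ.tendsto_atTop).const_mul (2 : ℝ)
  -- Two directions within `1 / 16` of `v` differ by at most `1 / 8`. The index `m` is chosen after
  -- `n`, to make `u (ψ m)` much shorter.
  have hdir := Metric.tendsto_nhds.mp hlim (1 / 16) (by norm_num)
  obtain ⟨n, hn, hnδ⟩ := (hdir.and (hzero.eventually_lt_const hδ)).exists
  obtain ⟨m, hm, hmn⟩ := (hdir.and (hzero.eventually_lt_const
    (show 0 < ‖f (u (ψ n))‖ / 16 by linarith [hu0 (ψ n)]))).exists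
  obtain ⟨w, hwW, hw, hle⟩ := hkey Λ (u (ψ n)) (huW _) (u (ψ m)) (huW _) (hu0 _)
    ((hun _).trans hnδ) (hu0 _) ((hun _).trans hmn).le (by
      rw [← dist_eq_norm]
      refine (dist_triangle_right _ _ v).trans ?_
      simp only [Function.comp_apply] at hn hm
      linarith) (fun j ↦ by
      obtain ⟨o, hoW, hon, ho⟩ := hHΛ (ψ m) _ (pow_mem (huH (ψ m)) j)
      refine ⟨o, hoW, ?_, ho⟩
      have : 0 < 1 / (((ψ m : ℕ) : ℝ) + 1) := by positivity
      linarith)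
  exact (hmin _ w hwW hw).not_ge hle

/-! ### Iterated normalizers in nilpotent groups -/

theorem Subgroup.isClosed_normalizer {G : Type*} [Group G] [TopologicalSpace G]
    [IsTopologicalGroup G] {Λ : Subgroup G} (hΛ : IsClosed (Λ : Set G)) :
    IsClosed (Subgroup.normalizer (Λ : Set G) : Set G) := by
  have : (Subgroup.normalizer (Λ : Set G) : Set G) =
      ⋂ n ∈ Λ, {g : G | g * n * g⁻¹ ∈ Λ} ∩ {g : G | g⁻¹ * n * g ∈ Λ} := by
    ext g
    simp only [SetLike.mem_coe, Set.mem_iInter, Set.mem_inter_iff, Set.mem_ofPred_eq]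
    refine ⟨fun hg n hn ↦ ⟨(mem_normalizer_iff.mp hg n).mp hn,
      (mem_normalizer_iff''.mp hg n).mp hn⟩, fun hg ↦ mem_normalizer_iff.mpr fun n ↦
      ⟨fun hn ↦ (hg n hn).1, fun hn ↦ ?_⟩⟩
    simpa [mul_assoc] using (hg _ hn).2
  rw [this]
  refine isClosed_biInter fun n _ ↦ (hΛ.preimage ?_).inter (hΛ.preimage ?_) <;> fun_prop

/-- The sequence starting at `Λ` in which each term is the normalizer of the previous one. -/
def Subgroup.normalizerSeries {G : Type*} [Group G] (Λ : Subgroup G) : ℕ → Subgroup G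
  | 0 => Λ
  | n + 1 => Subgroup.normalizer (Λ.normalizerSeries n : Set G)

theorem Subgroup.isClosed_normalizerSeries {G : Type*} [Group G] [TopologicalSpace G]
    [IsTopologicalGroup G] {Λ : Subgroup G} (hΛ : IsClosed (Λ : Set G)) (n : ℕ) :
    IsClosed (Λ.normalizerSeries n : Set G) := by
  induction n with
  | zero => exact hΛ
  | succ n ih => exact isClosed_normalizer ih

/-- Induction on `i` through `g * n * g⁻¹ = ⁅g, n⁆ * n`: the commutator lies one step further down
the central series, hence in the previous normalizer. For `j = 0` the normalizers exhaust `G`. -/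
theorem Subgroup.lowerCentralSeries_le_normalizerSeries {G : Type*} [Group G] (Λ : Subgroup G)
    {k : ℕ} (hk : (⊤ : Subgroup G).lowerCentralSeries k = ⊥) {i j : ℕ} (hij : i + j = k) :
    (⊤ : Subgroup G).lowerCentralSeries j ≤ Λ.normalizerSeries i := by
  induction i generalizing j with
  | zero => rw [← hij, zero_add] at hk; rw [hk]; exact bot_le
  | succ i ih =>
    have ih := ih (j := j + 1) (by omega)
    have hcomm : ∀ g ∈ (⊤ : Subgroup G).lowerCentralSeries j, ∀ n ∈ Λ.normalizerSeries i,
        g * n * g⁻¹ ∈ Λ.normalizerSeries i := fun g hg n hn ↦ by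
      have := mul_mem (ih (by
        rw [lowerCentralSeries_succ]
        exact commutator_mem_commutator hg (mem_top n))) hn
      simpa [commutatorElement_def] using this
    refine fun g hg ↦ mem_normalizer_iff.mpr fun n ↦ ⟨hcomm g hg n, fun hn ↦ ?_⟩
    simpa [mul_assoc] using hcomm g⁻¹ (inv_mem hg) _ hn

open scoped Pointwise in
/-- In a nilpotent Lie group, a subgroup which stays in a small neighborhood of a closed
subgroup `Γ`, in the sense of being contained in `U Γ`, is contained in `Γ`. -/
theorem Subgroup.exists_nhds_forall_le_of_lowerCentralSeries_eq_bot {E : Type*}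
    [NormedAddCommGroup E] [NormedSpace ℝ E] [FiniteDimensional ℝ E] {G : Type*} [Group G]
    [TopologicalSpace G] [ChartedSpace E G] [LieGroup 𝓘(ℝ, E) ∞ G] {k : ℕ}
    (hk : (⊤ : Subgroup G).lowerCentralSeries k = ⊥) {Γ : Subgroup G}
    (hΓ : IsClosed (Γ : Set G)) :
    ∃ U ∈ 𝓝 (1 : G), ∀ H : Subgroup G, (∀ h ∈ H, ∃ o ∈ U, o⁻¹ * h ∈ Γ) → H ≤ Γ := by
  have : IsTopologicalGroup G := topologicalGroup_of_lieGroup 𝓘(ℝ, E) ∞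
  suffices ∀ i ≤ k, ∃ U ∈ 𝓝 (1 : G), ∀ H : Subgroup G,
      (∀ h ∈ H, ∃ o ∈ U, o⁻¹ * h ∈ Γ.normalizerSeries i) → H ≤ Γ.normalizerSeries i from
    this 0 (Nat.zero_le k)
  intro i hi
  induction hi using Nat.decreasingInduction with
  | self =>
    refine ⟨Set.univ, univ_mem, fun H _ ↦ le_top.trans ?_⟩
    exact lowerCentralSeries_le_normalizerSeries Γ hk (j := 0) (add_zero k)
  | of_succ i hi ih =>
    obtain ⟨U, hU, hUH⟩ := ih
    set Λ := Γ.normalizerSeries i with hΛ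
    obtain ⟨V, hV, hVH⟩ := exists_nhds_forall_le_of_subset_mul (E := E) Λ
      (isClosed_normalizerSeries hΓ i)
    refine ⟨U ∩ V, inter_mem hU hV, fun H hH ↦ ?_⟩
    have hnorm : H ≤ normalizer (Λ : Set G) := hUH H fun h hh ↦ by
      obtain ⟨o, ho, hoh⟩ := hH h hh
      exact ⟨o, ho.1, le_normalizer hoh⟩
    -- As `H` normalizes `Λ`, the join `H ⊔ Λ` is the product set `HΛ`.
    refine le_sup_left.trans (hVH (H ⊔ Λ) le_sup_right fun x hx ↦ ?_)
    have hx' : x ∈ (H : Set G) * (Λ : Set G) := by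
      rwa [← coe_mul_of_left_le_normalizer_right H Λ hnorm]
    obtain ⟨h, hh, l, hl, rfl⟩ := hx'
    obtain ⟨o, ho, hoh⟩ := hH h hh
    exact ⟨o, ho.2, by simpa [mul_assoc] using mul_mem hoh hl⟩

/-! ### From small orbits to subgroups near `Γ` -/

theorem lemma2p2 {E : Type*} [NormedAddCommGroup E] [NormedSpace ℝ E] [FiniteDimensional ℝ E]
    {G : Type*} [Group G] [TopologicalSpace G] [ChartedSpace E G] [LieGroup 𝓘(ℝ, E) ∞ G]
    (k : ℕ) (Γ : Subgroup G) (hX : IsNilmanifold k Γ)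
    (d : MetricSpace (G ⧸ Γ))
    (hd : d.toUniformSpace.toTopologicalSpace = QuotientGroup.instTopologicalSpace Γ) :
    ∃ ε : ℝ, 0 < ε ∧ ∀ Y : Set (G ⧸ Γ), IsSubnilmanifold Γ Y →
      @Metric.diam (G ⧸ Γ) d.toPseudoMetricSpace Y < ε → ∃ x : G ⧸ Γ, Y = {x} := by
  have : IsTopologicalGroup G := topologicalGroup_of_lieGroup 𝓘(ℝ, E) ∞
  let _ : MetricSpace (G ⧸ Γ) := d.replaceTopology hd.symm
  have hcompact : CompactSpace (G ⧸ Γ) := hX.cocompact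
  -- `Γ` is the preimage of the base point, which is closed in a metric space.
  have hΓ : IsClosed (Γ : Set G) := by
    have h := (isClosed_singleton (x := ((1 : G) : G ⧸ Γ))).preimage
      (QuotientGroup.continuous_mk (N := Γ))
    convert h using 1
    ext g
    simp [eq_comm (a := (g : G ⧸ Γ)), QuotientGroup.eq]
  obtain ⟨U, hU, hUH⟩ := Subgroup.exists_nhds_forall_le_of_lowerCentralSeries_eq_bot (E := E)
    hX.lowerCentralSeries_eq_bot hΓ
  obtain ⟨V, hV, hV1, hVU⟩ : ∃ V : Set G, IsOpen V ∧ (1 : G) ∈ V ∧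
      ∀ a ∈ V, ∀ b ∈ V, a⁻¹ * b ∈ U := by
    have hc : ContinuousAt (fun z : G × G ↦ z.1⁻¹ * z.2) (1, 1) := by fun_prop
    obtain ⟨A, B, hA, hA1, hB, hB1, hAB⟩ := mem_nhds_prod_iff'.mp
      (hc.preimage_mem_nhds (t := U) (by simpa using hU))
    exact ⟨A ∩ B, hA.inter hB, ⟨hA1, hB1⟩, fun a ha b hb ↦
      hAB (show (a, b) ∈ A ×ˢ B from ⟨ha.1, hb.2⟩)⟩
  obtain ⟨ε, hε, hball⟩ := lebesgue_number_lemma_of_metric (s := (Set.univ : Set (G ⧸ Γ)))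
    (c := fun g : G ↦ (QuotientGroup.mk : G → G ⧸ Γ) '' ((fun v ↦ g * v) '' V)) isCompact_univ
    (fun g ↦ QuotientGroup.isOpenMap_coe _ ((isOpenMap_mul_left g) _ hV))
    (fun x _ ↦ by
      obtain ⟨g, rfl⟩ := QuotientGroup.mk_surjective x
      exact Set.mem_iUnion.mpr ⟨g, g, ⟨1, hV1, mul_one g⟩, rfl⟩)
  refine ⟨ε, hε, ?_⟩
  rintro Y ⟨-, H, x, -, rfl⟩ hdiam
  refine ⟨x, (Set.subset_singleton_iff_eq.mp ?_).resolve_left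
    (MulAction.nonempty_orbit (M := H) x).ne_empty⟩
  have hsub : MulAction.orbit H x ⊆ Metric.ball x ε := fun y hy ↦
    (Metric.dist_le_diam_of_mem (Metric.isBounded_of_compactSpace) hy
      (MulAction.mem_orbit_self x)).trans_lt hdiam
  obtain ⟨g₀, hg₀⟩ := hball x (Set.mem_univ x)
  obtain ⟨_, ⟨v, hv, rfl⟩, rfl⟩ := hg₀ (Metric.mem_ball_self hε)
  set g := g₀ * v with hg
  -- Both `g = g₀ * v` and `h * g` map into the image of `g₀V`, so `g⁻¹ * h * g ∈ v⁻¹ * w * Γ` with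
  -- `w ∈ V`.
  have hconj : H.map (MulAut.conj g⁻¹).toMonoidHom ≤ Γ := hUH _ fun z hz ↦ by
    obtain ⟨h, hh, rfl⟩ := hz
    obtain ⟨_, ⟨w, hw, rfl⟩, hwh⟩ := hg₀ (hsub (MulAction.mem_orbit _ (⟨h, hh⟩ : H)))
    refine ⟨v⁻¹ * w, hVU v hv w hw, ?_⟩
    have := QuotientGroup.eq.mp (show ((g₀ * w : G) : G ⧸ Γ) = ((h * g : G) : G ⧸ Γ) from hwh)
    simpa [hg, mul_assoc] using this
  rintro _ ⟨⟨h, hh⟩, rfl⟩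
  refine (QuotientGroup.eq.mpr ?_ : ((g : G) : G ⧸ Γ) = ((h * g : G) : G ⧸ Γ)).symm
  simpa [mul_assoc] using hconj (Subgroup.mem_map_of_mem _ hh)
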